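/- \textbf{Proposition (Gaussian kernel case).} Let $\mathcal{H}$ be a separable real Hilbert space, let $\sigma>0$, and let $H(\bar k)$ be the reproducing kernel Hilbert space of the Gaussian kernel $\bar k(x,y)=\exp(-\sigma\|x-y\|_{\mathcal H}^2)$ on $\mathcal{H}$. Let $P=\mathcal{N}(m,\Sigma)$ be a Gaussian distribution on $\mathcal{H}$ with mean $m\in\mathcal{H}$ and covariance operator $\Sigma$; that is, for $Y\sim P$ each $\langle Y,h\rangle$ ($h\in\mathcal H$) is a (possibly degenerate) univariate Gaussian variable, $\langle m,h\rangle=\mathbb{E}\langle Y,h\rangle$ and $\langle\Sigma h,h'\rangle=\mathrm{cov}(\langle Y,h\rangle,\langle Y,h'\rangle)$ for all $h,h'\in\mathcal H$. For an operator $L$ on $\mathcal{H}$ with an eigenexpansion $L=\sum_{r}\lambda_r\Psi_r^{\otimes 2}$, where $(\Psi_r)$ is a complete orthonormal basis of $\mathcal{H}$, put $|L|=\prod_r\lambda_r$ and, for $q\in\mathbb{R}$, $L^q=\sum_r\lambda_r^q\,\mathbf{1}_{\{\lambda_r>0\}}\Psi_r^{\otimes 2}$. Then $I+2\sigma\Sigma$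 and $I+4\sigma\Sigma$ have eigenexpansions; the products defining $|I+2\sigma\Sigma|$ and $|I+4\sigma\Sigma|$ converge unconditionally to positive numbers, which do not depend on the eigenexpansion; $(I+2\sigma\Sigma)^{-1/2}$ is a well-defined bounded operator, independent of the eigenexpansion; and there is exactly one $\bar\mu_P\in H(\bar k)$ such that every $f\in H(\bar k)$ is $P$-integrable with $\langle\bar\mu_P,f\rangle_{H(\bar k)}=\mathbb{E}_{Y\sim P}f(Y)$ (the kernel mean embedding of $P$). It satisfies \[ \bar\mu_P(y)=|I+2\sigma\Sigma|^{-1/2}\exp\!\left(-\sigma\left\|(I+2\sigma\Sigma)^{-1/2}(y-m)\right\|_{\mathcal H}^2\right)\quad\text{for all } y\in\mathcal{H}, \qquad \|\bar\mu_P\|_{H(\bar k)}^2=|I+4\sigma\Sigma|^{-1/2}. \] -/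

import Mathlib

open MeasureTheory ProbabilityTheory
open scoped InnerProductSpace NNReal

/-- The Gaussian kernel `k(x, y) = exp (-σ ‖x - y‖²)` on `H`. A kernel with values in `ℝ` is written
as a matrix of continuous linear maps `ℝ →L[ℝ] ℝ`: the entry `(x, y)` is multiplication by
`k(x, y)`. -/
noncomputable def gaussianKernel (H : Type*) [NormedAddCommGroup H] [InnerProductSpace ℝ H]
    (σ : ℝ≥0) : Matrix H H (ℝ →L[ℝ] ℝ) :=
  .of fun x y => Real.exp (-(σ : ℝ) * ‖x - y‖ ^ 2) • (1 : ℝ →L[ℝ] ℝ)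

theorem expGram_nonneg {H ι : Type*} [NormedAddCommGroup H] [InnerProductSpace ℝ H] [Fintype ι]
    {c : ℝ} (hc : 0 ≤ c) (x : ι → H) (a : ι → ℝ) :
    0 ≤ ∑ i, ∑ j, a i * a j * Real.exp (c * ⟪x i, x j⟫_ℝ) := by
  have hpow : ∀ n : ℕ, (Matrix.of fun i j : ι => ⟪x i, x j⟫_ℝ ^ n).PosSemidef := by
    intro n
    induction n with
    | zero =>
      have h := Matrix.posSemidef_gram ℝ (fun _ : ι => (1 : ℝ))
      have e : (Matrix.of fun i j : ι => ⟪x i, x j⟫_ℝ ^ 0) = Matrix.gram ℝ fun _ : ι => (1 : ℝ) := by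
        ext i j
        simp
      rw [e]
      exact h
    | succ n ih =>
      have h := Matrix.PosSemidef.hadamard ih (Matrix.posSemidef_gram ℝ x)
      have e : (Matrix.of fun i j : ι => ⟪x i, x j⟫_ℝ ^ (n + 1)) =
          Matrix.hadamard (Matrix.of fun i j : ι => ⟪x i, x j⟫_ℝ ^ n) (Matrix.gram ℝ x) := by
        ext i j
        simp [pow_succ]
      rw [e]
      exact h
  have hterm : ∀ n : ℕ,
      0 ≤ ∑ i, ∑ j, a i * a j * ((c * ⟪x i, x j⟫_ℝ) ^ n / (n.factorial : ℝ)) := by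
    intro n
    have h := (hpow n).dotProduct_mulVec_nonneg a
    have h2 : 0 ≤ c ^ n / (n.factorial : ℝ) := by positivity
    have h3 := mul_nonneg h2 h
    refine h3.trans_eq ?_
    simp only [dotProduct, Matrix.mulVec, Finset.mul_sum]
    refine Finset.sum_congr rfl fun i _ => Finset.sum_congr rfl fun j _ => ?_
    simp [mul_pow]
    ring
  have hs : HasSum (fun n : ℕ =>
      ∑ i, ∑ j, a i * a j * ((c * ⟪x i, x j⟫_ℝ) ^ n / (n.factorial : ℝ)))
      (∑ i, ∑ j, a i * a j * Real.exp (c * ⟪x i, x j⟫_ℝ)) := by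
    refine hasSum_sum fun i _ => hasSum_sum fun j _ => ?_
    have h := NormedSpace.expSeries_div_hasSum_exp (𝔸 := ℝ) (c * ⟪x i, x j⟫_ℝ)
    rw [← Real.exp_eq_exp_ℝ] at h
    exact h.mul_left (a i * a j)
  exact hs.nonneg hterm

theorem gaussianKernel_posSemidef (H : Type*) [NormedAddCommGroup H] [InnerProductSpace ℝ H]
    (σ : ℝ≥0) : (gaussianKernel H σ).PosSemidef := by
  have key : (gaussianKernel H σ).PosSemidef ↔ (gaussianKernel H σ).IsHermitian ∧
      ∀ v : H →₀ ℝ, 0 ≤ RCLike.re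
        (v.sum fun x w => v.sum fun x' w' => ⟪gaussianKernel H σ x' x w, w'⟫_ℝ) :=
    (RKHS.posSemidef_tfae (K := gaussianKernel H σ)).out 0 2
  refine key.mpr ⟨?_, fun v => ?_⟩
  · ext x y
    simp [gaussianKernel, Matrix.conjTranspose, norm_sub_rev x y]
  · have h := expGram_nonneg (c := 2 * σ) (by positivity) (fun i : v.support => (i : H))
      (fun i => v i * Real.exp (-(σ : ℝ) * ‖(i : H)‖ ^ 2))
    refine h.trans_eq ?_
    simp only [Finsupp.sum, ← Finset.sum_attach v.support, RCLike.re_to_real]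
    refine Finset.sum_congr rfl fun i _ => Finset.sum_congr rfl fun j _ => ?_
    simp only [gaussianKernel, Matrix.of_apply, smul_apply,
      one_apply_eq_self, smul_eq_mul, real_inner_eq_re_inner]
    have e : Real.exp (-(σ : ℝ) * ‖(j : H) - i‖ ^ 2) = Real.exp (-(σ : ℝ) * ‖(i : H)‖ ^ 2) *
        Real.exp (-(σ : ℝ) * ‖(j : H)‖ ^ 2) * Real.exp (2 * σ * ⟪(i : H), (j : H)⟫_ℝ) := by
      rw [← Real.exp_add, ← Real.exp_add, norm_sub_sq_real, real_inner_comm]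
      congr 1
      ring
    rw [e]
    simp
    ring

instance gaussianKernel_fact (H : Type*) [NormedAddCommGroup H] [InnerProductSpace ℝ H]
    (σ : ℝ≥0) : Fact (gaussianKernel H σ).PosSemidef :=
  ⟨gaussianKernel_posSemidef H σ⟩

/-- The reproducing kernel Hilbert space of the Gaussian kernel. -/
noncomputable abbrev GaussianRKHS (H : Type*) [NormedAddCommGroup H] [InnerProductSpace ℝ H]
    (σ : ℝ≥0) : Type _ :=
  RKHS.OfKernel (gaussianKernel H σ)

/-- `μ` is the embedding of the measure `P` in the reproducing kernel Hilbert space `F` of real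
functions on `X`: every `f ∈ F` is `P`-integrable, with expectation `⟪μ, f⟫`. -/
def IsMeanEmbedding {X F : Type*} [MeasurableSpace X] [NormedAddCommGroup F]
    [InnerProductSpace ℝ F] [RKHS ℝ F X ℝ] (P : Measure X) (μ : F) : Prop :=
  ∀ f : F, Integrable (fun x => f x) P ∧ ⟪μ, f⟫_ℝ = ∫ x, f x ∂P

section Operators

variable {H : Type*} [NormedAddCommGroup H] [InnerProductSpace ℝ H]

/-- `P` is the Gaussian law `N(m, S)` on `H`: all its one-dimensional marginals are Gaussian, `m` is
its mean and `S` its (centred) covariance operator. -/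
structure IsGaussianLaw [MeasurableSpace H] (m : H) (S : H →L[ℝ] H) (P : Measure H) : Prop where
  gaussian : IsGaussian P
  mean : ∀ h : H, ⟪m, h⟫_ℝ = ∫ x, ⟪x, h⟫_ℝ ∂P
  cov : ∀ h h' : H, ⟪S h, h'⟫_ℝ = covariance (fun x => ⟪x, h⟫_ℝ) (fun x => ⟪x, h'⟫_ℝ) P

/-- `(b, l)` is an eigenexpansion of `L`: `b` is an orthonormal Hilbert basis and
`L = ∑ i, l i • b i ⊗ b i`. -/
def IsEigenexpansion {ι : Type*} (L : H →L[ℝ] H) (b : HilbertBasis ι ℝ H) (l : ι → ℝ) : Prop :=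
  ∀ i, L (b i) = l i • b i

/-- `L` has an eigenexpansion (the basis is indexed, without loss of generality, by a set of
vectors). -/
def HasEigenexpansion (L : H →L[ℝ] H) : Prop :=
  ∃ (s : Set H) (b : HilbertBasis s ℝ H) (l : s → ℝ), IsEigenexpansion L b l

/-- `L` has the determinant `d`: `L` has an eigenexpansion, and for every eigenexpansion the product
of the eigenvalues, repeated with multiplicity, converges unconditionally to `d`. -/
def HasDeterminant (L : H →L[ℝ] H) (d : ℝ) : Prop :=
  HasEigenexpansion L ∧ ∀ (s : Set H) (b : HilbertBasis s ℝ H) (l : s → ℝ),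
    IsEigenexpansion L b l → HasProd l d

/-- `R = L ^ q`: `L` has an eigenexpansion, and for every eigenexpansion `(b, l)` of `L` one has
`R = ∑ i, l i ^ q • 1_{l i > 0} • b i ⊗ b i`. -/
def IsOperatorPower (L : H →L[ℝ] H) (q : ℝ) (R : H →L[ℝ] H) : Prop :=
  HasEigenexpansion L ∧ ∀ (s : Set H) (b : HilbertBasis s ℝ H) (l : s → ℝ),
    IsEigenexpansion L b l → IsEigenexpansion R b fun i => if 0 < l i then l i ^ q else 0

end Operators

/-! The mean embedding is the Bochner integral of the bounded feature map `x ↦ k(x, ·)`. Its value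
at `y` is `E exp (-σ ‖Y - y‖²)`, and pairing it with itself gives its squared norm as the
expectation of those values. Only Gaussian integrals of diagonal quadratic forms remain.

The covariance `S` is an integral of rank-one operators, hence compact, and being symmetric it has
an eigenbasis. The coordinates of `Y` in that basis are jointly Gaussian and uncorrelated, hence
independent, so the integral is a product of one-dimensional ones
(`IsGaussianLaw.hasProd_eigenexpansion`). Constant weights `σ` give the values; weights `σ / (1 +
2σλᵢ)` centred at `m` give the norm.

The determinants need no separate trace estimate: `∏ (1 + cλᵢ) ^ (-1 / 2)` converges to a positive
expectation that does not mention the basis. -/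

/-! ### Hilbert bases and eigenexpansions -/

section HilbertSpace

variable {H : Type*} [NormedAddCommGroup H] [InnerProductSpace ℝ H]

/-- Distinct basis vectors are `√2` apart. Countability is what later permits dominated convergence
along finite subsets of the index. -/
theorem HilbertBasis.countable_index [TopologicalSpace.SeparableSpace H] {ι : Type*}
    (b : HilbertBasis ι ℝ H) : Countable ι := by
  refine Pairwise.countable_of_isOpen_disjoint (s := fun i => Metric.ball (b i) (1 / 2)) ?_
    (fun i => Metric.isOpen_ball) fun i => ⟨b i, Metric.mem_ball_self (by norm_num)⟩
  intro i j hij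
  refine Metric.ball_disjoint_ball ?_
  have h : ‖b i - b j‖ ^ 2 = 2 := by
    rw [norm_sub_sq_real, b.orthonormal.2 hij, b.orthonormal.1, b.orthonormal.1]
    norm_num
  rw [dist_eq_norm]
  nlinarith [norm_nonneg (b i - b j)]

theorem HilbertBasis.hasSum_inner_sq {ι : Type*} (b : HilbertBasis ι ℝ H) (x : H) :
    HasSum (fun i => ⟪x, b i⟫_ℝ ^ 2) (‖x‖ ^ 2) := by
  have h := b.hasSum_inner_mul_inner x x
  rw [real_inner_self_eq_norm_sq] at h
  refine h.congr_fun fun i => ?_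
  rw [real_inner_comm x (b i), sq]

theorem HilbertBasis.ext_inner {ι : Type*} (b : HilbertBasis ι ℝ H) {x y : H}
    (h : ∀ i, ⟪x, b i⟫_ℝ = ⟪y, b i⟫_ℝ) : x = y := by
  have h0 := b.hasSum_inner_sq (x - y)
  simp only [inner_sub_left, h, sub_self] at h0
  have h1 : ‖x - y‖ ^ 2 = 0 := h0.unique (by simp)
  exact sub_eq_zero.1 (norm_eq_zero.1 (pow_eq_zero_iff two_ne_zero |>.1 h1))

theorem HilbertBasis.exists_diagonal {ι : Type*} (b : HilbertBasis ι ℝ H) (f : ι → ℝ) {C : ℝ}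
    (hf : ∀ i, |f i| ≤ C) : ∃ R : H →L[ℝ] H, ∀ i, R (b i) = f i • b i := by
  classical
  let g : lp (fun _ : ι => ℝ) 2 →ₗ[ℝ] lp (fun _ : ι => ℝ) 2 :=
    { toFun := fun x => ⟨fun i => f i * x i, by
        have h := (lp.memℓp x).summable (by norm_num)
        refine memℓp_gen (Summable.of_nonneg_of_le (fun i => by positivity) (fun i => ?_)
          (h.mul_left (C ^ 2)))
        simp only [ENNReal.toReal_ofNat, Real.rpow_ofNat, norm_mul, mul_pow, Real.norm_eq_abs]
        gcongr
        exact hf i⟩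
      map_add' := fun x y => by
        ext i
        exact mul_add (f i) (x i) (y i)
      map_smul' := fun c x => by
        ext i
        exact mul_left_comm (f i) c (x i) }
  -- The absolute value matters for empty `ι`, where `C` may be negative.
  have hg : ∀ x, ‖g x‖ ≤ |C| * ‖x‖ := by
    intro x
    refine lp.norm_le_of_forall_sum_le (by norm_num) (by positivity) fun s => ?_
    have h := lp.sum_rpow_le_norm_rpow (p := 2) (by norm_num) x s
    simp only [ENNReal.toReal_ofNat, Real.rpow_ofNat, mul_pow] at h ⊢
    refine le_trans ?_ (mul_le_mul_of_nonneg_left h (by positivity))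
    rw [Finset.mul_sum]
    refine Finset.sum_le_sum fun i _ => ?_
    change ‖f i * x i‖ ^ 2 ≤ _
    rw [norm_mul, mul_pow, Real.norm_eq_abs (f i)]
    exact mul_le_mul_of_nonneg_right (pow_le_pow_left₀ (abs_nonneg _)
      ((hf i).trans (le_abs_self C)) 2) (by positivity)
  refine ⟨b.repr.symm.toContinuousLinearEquiv.toContinuousLinearMap ∘L
    (g.mkContinuous |C| hg) ∘L b.repr.toContinuousLinearEquiv.toContinuousLinearMap, fun i => ?_⟩
  apply b.repr.injective
  ext j
  have h1 : b.repr (b i) = lp.single 2 i (1 : ℝ) := b.repr_self i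
  have h2 : (g (b.repr (b i)) : ι → ℝ) j = f j * b.repr (b i) j := rfl
  simp only [ContinuousLinearMap.comp_apply, ContinuousLinearEquiv.coe_coe,
    LinearIsometryEquiv.coe_toContinuousLinearEquiv, LinearIsometryEquiv.apply_symm_apply,
    LinearMap.mkContinuous_apply, map_smul, lp.coeFn_smul, Pi.smul_apply, smul_eq_mul]
  rw [h2, h1]
  by_cases hij : j = i
  · subst hij; simp
  · simp [hij]

/-- Both sides are continuous and linear in `x`, so it suffices to compare them on the basis
expansion of `x`; no symmetry of `L` is assumed. -/
theorem IsEigenexpansion.inner_apply {ι : Type*} {L : H →L[ℝ] H} {b : HilbertBasis ι ℝ H}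
    {l : ι → ℝ} (h : IsEigenexpansion L b l) (x : H) (i : ι) : ⟪L x, b i⟫_ℝ = l i * ⟪x, b i⟫_ℝ := by
  have h1 := (b.hasSum_repr x).mapL ((innerSL ℝ (b i)) ∘L L)
  have h2 := (b.hasSum_repr x).mapL (l i • innerSL ℝ (b i))
  have h3 : ∀ j, ((innerSL ℝ (b i)) ∘L L) (b.repr x j • b j) =
      (l i • innerSL ℝ (b i)) (b.repr x j • b j) := by
    intro j
    simp only [ContinuousLinearMap.comp_apply, map_smul, h j, innerSL_apply_apply,
      smul_apply, smul_eq_mul]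
    by_cases hij : i = j
    · rw [hij]
    · rw [b.orthonormal.2 hij]; ring
  simp only [h3] at h1
  have h4 := h1.unique h2
  simp only [ContinuousLinearMap.comp_apply, innerSL_apply_apply, smul_apply,
    smul_eq_mul] at h4
  rw [real_inner_comm, h4, real_inner_comm]

/-- A diagonal operator is diagonal, with eigenvalues transformed in the same way, in every
eigenexpansion. -/
theorem IsEigenexpansion.transfer {ι κ : Type*} {L R : H →L[ℝ] H} {b : HilbertBasis ι ℝ H}
    {l : ι → ℝ} {f : ℝ → ℝ} (hL : IsEigenexpansion L b l)
    (hR : IsEigenexpansion R b fun i => f (l i)) {b' : HilbertBasis κ ℝ H} {l' : κ → ℝ}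
    (hL' : IsEigenexpansion L b' l') : IsEigenexpansion R b' fun k => f (l' k) := by
  intro k
  refine b.ext_inner fun i => ?_
  rw [hR.inner_apply, inner_smul_left]
  have h := hL.inner_apply (b' k) i
  rw [hL' k, inner_smul_left] at h
  simp only [conj_trivial] at h ⊢
  -- Eigenvectors from the two bases that are not orthogonal have the same eigenvalue.
  by_cases h0 : ⟪b' k, b i⟫_ℝ = 0
  · simp [h0]
  · rw [mul_right_cancel₀ h0 h]

theorem IsEigenexpansion.one_add_smul {ι : Type*} {S : H →L[ℝ] H} {b : HilbertBasis ι ℝ H}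
    {l : ι → ℝ} (h : IsEigenexpansion S b l) (c : ℝ) :
    IsEigenexpansion (1 + c • S) b fun i => 1 + c * l i := by
  intro i
  simp [h i, add_smul, mul_smul]

theorem IsEigenexpansion.of_one_add_smul {ι : Type*} {S : H →L[ℝ] H} {b : HilbertBasis ι ℝ H}
    {l : ι → ℝ} {c : ℝ} (hc : c ≠ 0) (h : IsEigenexpansion (1 + c • S) b l) :
    IsEigenexpansion S b fun i => (l i - 1) / c := by
  intro i
  have h1 := h i
  simp only [add_apply, one_apply_eq_self,
    smul_apply] at h1
  have h2 : c • S (b i) = (l i - 1) • b i := by rw [sub_smul, one_smul, ← h1, add_sub_cancel_left]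
  change S (b i) = ((l i - 1) / c) • b i
  rw [div_eq_inv_mul, mul_smul, ← h2, smul_smul, inv_mul_cancel₀ hc, one_smul]

/-- Hilbert bases of all eigenspaces, the kernel included, are glued together. Distinct eigenspaces
are orthogonal, and the spectral theorem leaves nothing orthogonal to all of them. -/
theorem HasEigenexpansion.of_isCompactOperator [CompleteSpace H] {T : H →L[ℝ] H}
    (hT : IsCompactOperator T) (hs : (T : H →ₗ[ℝ] H).IsSymmetric) : HasEigenexpansion T := by
  classical
  let V : ℝ → Submodule ℝ H := fun μ => Module.End.eigenspace (T : Module.End ℝ H) μ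
  have hV : ∀ μ, IsClosed (V μ : Set H) := fun μ => by
    have h : (V μ : Set H) = {x | T x = μ • x} := by
      ext x
      simp [V]
    rw [h]
    exact isClosed_eq T.continuous (continuous_const_smul μ)
  have hVc : ∀ μ, CompleteSpace (V μ) := fun μ => (hV μ).completeSpace_coe
  choose w bw hbw using fun μ => exists_hilbertBasis ℝ (V μ)
  have hon := hs.orthogonalFamily_eigenspaces.orthonormal_sigma_orthonormal
    (v_family := fun μ => bw μ) fun μ => (bw μ).orthonormal
  set v : (Σ μ, w μ) → H := fun a => (V a.1).subtypeₗᵢ (bw a.1 a.2) with hv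
  have hperp : (Submodule.span ℝ (Set.range v))ᗮ = ⊥ := by
    rw [eq_bot_iff, ← ContinuousLinearMap.orthogonalComplement_iSup_eigenspaces_eq_bot hT hs]
    intro x hx
    rw [Submodule.mem_orthogonal] at hx ⊢
    suffices (⨆ μ, V μ) ≤ (ℝ ∙ x)ᗮ from fun u hu =>
      Submodule.mem_orthogonal_singleton_iff_inner_left.1 (this hu)
    refine iSup_le fun μ u hu => ?_
    rw [Submodule.mem_orthogonal_singleton_iff_inner_left]
    have h1 := ((bw μ).hasSum_repr ⟨u, hu⟩).mapL ((innerSL ℝ x) ∘L (V μ).subtypeL)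
    have h2 : ∀ i, ((innerSL ℝ x) ∘L (V μ).subtypeL) ((bw μ).repr ⟨u, hu⟩ i • bw μ i) = 0 := by
      intro i
      have h3 := hx (v ⟨μ, i⟩) (Submodule.subset_span ⟨_, rfl⟩)
      rw [real_inner_comm] at h3
      rw [map_smul]
      refine smul_eq_zero_of_right _ h3
    simp only [h2] at h1
    have h4 := h1.unique hasSum_zero
    rw [real_inner_comm]
    exact h4
  have hr : Set.range ((↑) : Set.range v → H) = Set.range v := Subtype.range_coe
  -- The eigenvalue of `x` is the first component of a chosen preimage of `x` under `v`.
  refine ⟨Set.range v, HilbertBasis.mkOfOrthogonalEqBot hon.toSubtypeRange (by rw [hr, hperp]),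
    fun x => (x.2.choose).1, fun x => ?_⟩
  rw [HilbertBasis.coe_mkOfOrthogonalEqBot]
  have h := (bw x.2.choose.1 x.2.choose.2).2
  have hx : v x.2.choose = x := x.2.choose_spec
  have h5 : ((bw x.2.choose.1 x.2.choose.2 : V _) : H) = x := hx
  rw [h5] at h
  exact Module.End.mem_eigenspace_iff.1 h

end HilbertSpace

/-! ### Gaussian integrals on the real line -/

theorem integral_exp_neg_mul_sq_gaussianReal (μ y : ℝ) (v : ℝ≥0) {a : ℝ} (ha : 0 ≤ a) :
    ∫ x, Real.exp (-(a * (x - y) ^ 2)) ∂gaussianReal μ v =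
      (1 + 2 * a * v) ^ (-1 / 2 : ℝ) * Real.exp (-(a * (μ - y) ^ 2 / (1 + 2 * a * v))) := by
  rcases eq_or_ne v 0 with rfl | hv
  · simp
  have hv0 : (0 : ℝ) < v := by exact_mod_cast pos_iff_ne_zero.2 hv
  have hD : 0 < 1 + 2 * a * v := by positivity
  set D : ℝ := 1 + 2 * a * v with hDdef
  -- Completing the square: `t` is the centre of the product of the two Gaussians, and `D / (2v) = a
  -- + 1 / (2v)` is its rate.
  set t : ℝ := (2 * a * v * y + μ) / D with ht
  rw [integral_gaussianReal_eq_integral_smul hv]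
  have h1 : ∀ x : ℝ, gaussianPDFReal μ v x • Real.exp (-(a * (x - y) ^ 2)) =
      (√(2 * Real.pi * v))⁻¹ * Real.exp (-(a * (μ - y) ^ 2 / D)) *
        Real.exp (-(D / (2 * v)) * (x - t) ^ 2) := by
    intro x
    rw [gaussianPDFReal, smul_eq_mul, mul_assoc _ (Real.exp _), mul_assoc _ (Real.exp _), ← Real.exp_add,
      ← Real.exp_add]
    congr 2
    rw [ht]
    field_simp
    rw [hDdef]
    ring
  simp_rw [h1]
  rw [integral_const_mul, integral_sub_right_eq_self
    (fun x : ℝ => Real.exp (-(D / (2 * v)) * x ^ 2)) t, integral_gaussian]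
  have h2 : Real.pi / (D / (2 * v)) = 2 * Real.pi * v * D⁻¹ := by field_simp
  have h3 : D ^ (-1 / 2 : ℝ) = √(D⁻¹) := by
    rw [Real.sqrt_eq_rpow, ← Real.rpow_neg_one, ← Real.rpow_mul hD.le]
    norm_num
  have h4 : √(2 * Real.pi * v) ≠ 0 := by positivity
  rw [h2, h3, Real.sqrt_mul (x := 2 * Real.pi * v) (by positivity),
    mul_right_comm, inv_mul_cancel_left₀ h4]

/-! ### Gaussian laws on a Hilbert space -/

section GaussianLaw

variable {H : Type*} [NormedAddCommGroup H] [InnerProductSpace ℝ H] [MeasurableSpace H]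
  {m : H} {S : H →L[ℝ] H} {P : Measure H}

theorem IsGaussianLaw.isProbabilityMeasure (hP : IsGaussianLaw m S P) : IsProbabilityMeasure P :=
  have := hP.gaussian
  inferInstance

theorem IsGaussianLaw.inner_eq_integral (hP : IsGaussianLaw m S P) (h h' : H) :
    ⟪S h, h'⟫_ℝ = ∫ x, ⟪x - m, h⟫_ℝ * ⟪x - m, h'⟫_ℝ ∂P := by
  rw [hP.cov, covariance]
  simp only [← hP.mean, inner_sub_left]

theorem IsGaussianLaw.isSymmetric (hP : IsGaussianLaw m S P) : (S : H →ₗ[ℝ] H).IsSymmetric := by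
  intro h h'
  rw [real_inner_comm _ h]
  change ⟪S h, h'⟫_ℝ = ⟪S h', h⟫_ℝ
  rw [hP.inner_eq_integral, hP.inner_eq_integral]
  simp only [mul_comm]

variable [TopologicalSpace.SeparableSpace H] [BorelSpace H]

theorem IsGaussianLaw.inner_nonneg (hP : IsGaussianLaw m S P) (h : H) : 0 ≤ ⟪S h, h⟫_ℝ := by
  have := UniformSpace.secondCountable_of_separable H
  rw [hP.cov, covariance_self (by fun_prop)]
  exact variance_nonneg _ _

theorem IsGaussianLaw.map_inner (hP : IsGaussianLaw m S P) (h : H) :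
    P.map (fun x => ⟪x, h⟫_ℝ) = gaussianReal ⟪m, h⟫_ℝ (⟪S h, h⟫_ℝ).toNNReal := by
  have := UniformSpace.secondCountable_of_separable H
  have := hP.gaussian
  have hX : HasGaussianLaw (fun x : H => ⟪x, h⟫_ℝ) P := by
    have h1 := (IsGaussian.hasGaussianLaw_id (μ := P)).map_fun (innerSL ℝ h)
    simpa only [innerSL_apply_apply, id, real_inner_comm] using h1
  rw [hX.map_eq_gaussianReal, hP.cov, hP.mean, covariance_self (by fun_prop)]

theorem IsGaussianLaw.integral_exp_inner (hP : IsGaussianLaw m S P) (h y : H) {a : ℝ}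
    (ha : 0 ≤ a) :
    ∫ x, Real.exp (-(a * ⟪x - y, h⟫_ℝ ^ 2)) ∂P =
      (1 + 2 * a * ⟪S h, h⟫_ℝ) ^ (-1 / 2 : ℝ) *
        Real.exp (-(a * ⟪m - y, h⟫_ℝ ^ 2 / (1 + 2 * a * ⟪S h, h⟫_ℝ))) := by
  have := UniformSpace.secondCountable_of_separable H
  have h1 := integral_exp_neg_mul_sq_gaussianReal ⟪m, h⟫_ℝ ⟪y, h⟫_ℝ (⟪S h, h⟫_ℝ).toNNReal ha
  rw [← hP.map_inner, integral_map (by fun_prop) (by fun_prop),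
    Real.coe_toNNReal _ (hP.inner_nonneg h)] at h1
  simpa only [inner_sub_left] using h1

/-- Jointly Gaussian and uncorrelated coordinates are independent, so the expectation factors. -/
theorem IsGaussianLaw.integral_prod_exp_inner (hP : IsGaussianLaw m S P) {ι : Type*} [Fintype ι]
    {v : ι → H} (hv : ∀ i j, i ≠ j → ⟪S (v i), v j⟫_ℝ = 0) (y : H) {a : ι → ℝ}
    (ha : ∀ i, 0 ≤ a i) :
    ∫ x, ∏ i, Real.exp (-(a i * ⟪x - y, v i⟫_ℝ ^ 2)) ∂P =
      ∏ i, (1 + 2 * a i * ⟪S (v i), v i⟫_ℝ) ^ (-1 / 2 : ℝ) *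
        Real.exp (-(a i * ⟪m - y, v i⟫_ℝ ^ 2 / (1 + 2 * a i * ⟪S (v i), v i⟫_ℝ))) := by
  have := UniformSpace.secondCountable_of_separable H
  have := hP.gaussian
  have hX : HasGaussianLaw (fun x : H => fun i => ⟪x, v i⟫_ℝ) P := by
    have h1 := (IsGaussian.hasGaussianLaw_id (μ := P)).map_fun
      (ContinuousLinearMap.pi fun i => innerSL ℝ (v i))
    have h2 : (fun x : H => fun i => ⟪x, v i⟫_ℝ) =
        fun x => ContinuousLinearMap.pi (fun i => innerSL ℝ (v i)) (id x) := by
      funext x i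
      exact real_inner_comm _ _
    rwa [h2]
  have hind := hX.iIndepFun_of_covariance_eq_zero fun i j hij => by
    rw [← hP.cov, hv i j hij]
  have h2 := hind.integral_fun_prod_comp (f := fun i t => Real.exp (-(a i * (t - ⟪y, v i⟫_ℝ) ^ 2)))
    (fun i => by fun_prop) (fun i => by fun_prop)
  simp only [← inner_sub_left] at h2
  rw [h2]
  exact Finset.prod_congr rfl fun i _ => hP.integral_exp_inner (v i) y (ha i)

/-- Partial products lie in `[0, 1]`, so dominated convergence under a probability measure passes
from finite to unconditional products. -/
theorem IsGaussianLaw.hasProd_integral_exp (hP : IsGaussianLaw m S P) {ι : Type*} [Countable ι]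
    {v : ι → H} (hv : ∀ i j, i ≠ j → ⟪S (v i), v j⟫_ℝ = 0) (y : H) {a : ι → ℝ}
    (ha : ∀ i, 0 ≤ a i) {g : H → ℝ}
    (hg : ∀ x, HasSum (fun i => a i * ⟪x - y, v i⟫_ℝ ^ 2) (g x)) :
    HasProd (fun i => (1 + 2 * a i * ⟪S (v i), v i⟫_ℝ) ^ (-1 / 2 : ℝ) *
      Real.exp (-(a i * ⟪m - y, v i⟫_ℝ ^ 2 / (1 + 2 * a i * ⟪S (v i), v i⟫_ℝ))))
      (∫ x, Real.exp (-g x) ∂P) := by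
  have := UniformSpace.secondCountable_of_separable H
  have := hP.isProbabilityMeasure
  have h1 : ∀ J : Finset ι, ∏ i ∈ J, (1 + 2 * a i * ⟪S (v i), v i⟫_ℝ) ^ (-1 / 2 : ℝ) *
      Real.exp (-(a i * ⟪m - y, v i⟫_ℝ ^ 2 / (1 + 2 * a i * ⟪S (v i), v i⟫_ℝ))) =
      ∫ x, ∏ i ∈ J, Real.exp (-(a i * ⟪x - y, v i⟫_ℝ ^ 2)) ∂P := by
    intro J
    have h2 := hP.integral_prod_exp_inner (v := fun i : J => v i)
      (fun i j hij => hv i j (Subtype.coe_injective.ne hij)) y (fun i : J => ha i)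
    rw [← Finset.prod_coe_sort, ← h2]
    refine integral_congr_ae (.of_forall fun x => ?_)
    exact Finset.prod_coe_sort J fun i => Real.exp (-(a i * ⟪x - y, v i⟫_ℝ ^ 2))
  rw [HasProd]
  simp only [h1, SummationFilter.unconditional_filter]
  refine tendsto_integral_filter_of_dominated_convergence (fun _ => 1)
    (.of_forall fun J => ?_) (.of_forall fun J => .of_forall fun x => ?_)
    (integrable_const _) (.of_forall fun x => ?_)
  · fun_prop
  · rw [Real.norm_of_nonneg (by positivity)]
    refine Finset.prod_le_one (fun i _ => by positivity) fun i _ => ?_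
    rw [Real.exp_le_one_iff, neg_nonpos]
    exact mul_nonneg (ha i) (sq_nonneg _)
  · simpa [HasProd] using (hg x).neg.rexp

variable [CompleteSpace H]

theorem IsGaussianLaw.memLp_sub (hP : IsGaussianLaw m S P) : MemLp (fun x => x - m) 2 P := by
  have := UniformSpace.secondCountable_of_separable H
  have := hP.gaussian
  exact (IsGaussian.memLp_two_id (μ := P)).sub (memLp_const m)

/-- `S = E (Y - m) ⊗ (Y - m)` converges in operator norm because Gaussian laws have finite second
moment, and the compact operators form a closed subspace. -/
theorem IsGaussianLaw.isCompactOperator (hP : IsGaussianLaw m S P) : IsCompactOperator S := by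
  have := UniformSpace.secondCountable_of_separable H
  have := hP.isProbabilityMeasure
  let T : H → H →L[ℝ] H := fun x => InnerProductSpace.rankOne ℝ (x - m) (x - m)
  have hc : Continuous T := by
    have h1 : Continuous fun x : H => x - m := by fun_prop
    exact ((InnerProductSpace.rankOne ℝ).continuous.comp h1).clm_apply h1
  have hT : Integrable T P := by
    refine Integrable.mono' (hP.memLp_sub.integrable_norm_pow two_ne_zero) hc.aestronglyMeasurable
      (.of_forall fun x => ?_)
    rw [InnerProductSpace.norm_rankOne, sq]
  have hS : S = ∫ x, T x ∂P := by
    ext h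
    refine ext_inner_right ℝ fun h' => ?_
    rw [ContinuousLinearMap.integral_apply hT, hP.inner_eq_integral, real_inner_comm,
      ← integral_inner (hT.apply_continuousLinearMap h)]
    refine integral_congr_ae (.of_forall fun x => ?_)
    simp only [T, InnerProductSpace.rankOne_apply, inner_smul_right, real_inner_comm]
  have hmem : S ∈ (compactOperator (RingHom.id ℝ) H H : Set (H →L[ℝ] H)) := by
    rw [hS]
    refine (Submodule.convex _).integral_mem isClosed_setOfPred_isCompactOperator
      (.of_forall fun x => ?_) hT
    have h2 : IsCompactOperator (innerSL ℝ (x - m)) :=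
      isCompactOperator_of_locallyCompactSpace_dom (innerSL ℝ (x - m))
    exact h2.clm_comp (ContinuousLinearMap.toSpanSingleton ℝ (x - m))
  exact hmem

end GaussianLaw

/-! ### Determinants and powers of the perturbed covariance operator -/

section Determinant

variable {H : Type*} [NormedAddCommGroup H] [InnerProductSpace ℝ H]

theorem HasDeterminant.hasProd_rpow {L : H →L[ℝ] H} {d : ℝ} (h : HasDeterminant L d) (hd : 0 < d)
    {s : Set H} {b : HilbertBasis s ℝ H} {l : s → ℝ} (hl : IsEigenexpansion L b l)
    (hpos : ∀ i, 0 < l i) (q : ℝ) : HasProd (fun i => l i ^ q) (d ^ q) := by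
  refine ((Real.continuousAt_rpow_const d q (.inl hd.ne')).tendsto.comp (h.2 s b l hl)).congr
    fun J => ?_
  rw [Function.comp_apply, Real.finsetProd_rpow _ _ fun i _ => (hpos i).le]

variable [TopologicalSpace.SeparableSpace H] [MeasurableSpace H] [BorelSpace H]
  {m : H} {S : H →L[ℝ] H} {P : Measure H}

theorem IsGaussianLaw.eigenvalue_nonneg (hP : IsGaussianLaw m S P) {ι : Type*}
    {b : HilbertBasis ι ℝ H} {l : ι → ℝ} (h : IsEigenexpansion S b l) (i : ι) : 0 ≤ l i := by
  have h1 := hP.inner_nonneg (b i)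
  rwa [h.inner_apply, real_inner_self_eq_norm_sq, b.orthonormal.1, one_pow, mul_one] at h1

theorem IsGaussianLaw.integral_exp_norm_pos (hP : IsGaussianLaw m S P) {c : ℝ} (hc : 0 ≤ c) :
    0 < ∫ x, Real.exp (-(c * ‖x - m‖ ^ 2)) ∂P := by
  have := UniformSpace.secondCountable_of_separable H
  have := hP.isProbabilityMeasure
  refine integral_exp_pos (Integrable.of_bound (C := 1) (by fun_prop) (.of_forall fun x => ?_))
  rw [Real.norm_of_nonneg (by positivity), Real.exp_le_one_iff, neg_nonpos]
  positivity

/-- The expectation of the exponential of a diagonal quadratic form, as a product over an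
eigenexpansion of the covariance operator. -/
theorem IsGaussianLaw.hasProd_eigenexpansion (hP : IsGaussianLaw m S P) {ι : Type*}
    {b : HilbertBasis ι ℝ H} {l : ι → ℝ} (h : IsEigenexpansion S b l) (y : H) {a : ι → ℝ}
    (ha : ∀ i, 0 ≤ a i) {g : H → ℝ}
    (hg : ∀ x, HasSum (fun i => a i * ⟪x - y, b i⟫_ℝ ^ 2) (g x)) :
    HasProd (fun i => (1 + 2 * a i * l i) ^ (-1 / 2 : ℝ) *
      Real.exp (-(a i * ⟪m - y, b i⟫_ℝ ^ 2 / (1 + 2 * a i * l i))))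
      (∫ x, Real.exp (-g x) ∂P) := by
  have := b.countable_index
  have h1 := hP.hasProd_integral_exp (v := b) (fun i j hij => ?_) y ha hg
  · have h2 : ∀ i, ⟪S (b i), b i⟫_ℝ = l i := fun i => by
      rw [h.inner_apply, real_inner_self_eq_norm_sq, b.orthonormal.1, one_pow, mul_one]
    simpa only [h2] using h1
  · rw [h.inner_apply, b.orthonormal.2 hij, mul_zero]

/-- `det (1 + c S) ^ (-1 / 2) = E exp (-(c / 2) ‖X - m‖²)`, for every eigenexpansion of `S`. -/
theorem IsGaussianLaw.hasProd_rpow (hP : IsGaussianLaw m S P) {ι : Type*}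
    {b : HilbertBasis ι ℝ H} {l : ι → ℝ} (h : IsEigenexpansion S b l) {c : ℝ} (hc : 0 ≤ c) :
    HasProd (fun i => (1 + c * l i) ^ (-1 / 2 : ℝ))
      (∫ x, Real.exp (-(c / 2 * ‖x - m‖ ^ 2)) ∂P) := by
  have h1 := hP.hasProd_eigenexpansion h m (a := fun _ => c / 2) (fun _ => by positivity)
    fun x => (b.hasSum_inner_sq (x - m)).mul_left (c / 2)
  have h2 : 2 * (c / 2) = c := by ring
  simpa [h2] using h1

variable [CompleteSpace H]

theorem IsGaussianLaw.hasEigenexpansion (hP : IsGaussianLaw m S P) : HasEigenexpansion S :=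
  .of_isCompactOperator hP.isCompactOperator hP.isSymmetric

theorem IsGaussianLaw.hasEigenexpansion_one_add_smul (hP : IsGaussianLaw m S P) (c : ℝ) :
    HasEigenexpansion (1 + c • S) :=
  let ⟨s, b, _, h⟩ := hP.hasEigenexpansion
  ⟨s, b, _, h.one_add_smul c⟩

/-- As `c ≠ 0`, each eigenexpansion of `1 + c • S` comes from one of `S`. The product of the `-1 /
2` powers has a nonzero limit, where `t ↦ t ^ (-2)` is continuous. -/
theorem IsGaussianLaw.hasDeterminant (hP : IsGaussianLaw m S P) {c : ℝ} (hc : 0 < c) :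
    HasDeterminant (1 + c • S) ((∫ x, Real.exp (-(c / 2 * ‖x - m‖ ^ 2)) ∂P) ^ (-2 : ℝ)) := by
  refine ⟨hP.hasEigenexpansion_one_add_smul c, fun s b l h => ?_⟩
  have h0 := h.of_one_add_smul hc.ne'
  have h1 := hP.hasProd_rpow h0 hc.le
  have h2 := (Real.continuousAt_rpow_const _ (-2 : ℝ)
    (.inl (hP.integral_exp_norm_pos (c := c / 2) (by positivity)).ne')).tendsto.comp h1
  refine h2.congr fun J => ?_
  have h3 : ∀ i, 0 ≤ 1 + c * ((l i - 1) / c) := fun i => by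
    have := hP.eigenvalue_nonneg h0 i
    positivity
  rw [Function.comp_apply, ← Real.finsetProd_rpow _ _ fun i _ => Real.rpow_nonneg (h3 i) _]
  refine Finset.prod_congr rfl fun i _ => ?_
  rw [← Real.rpow_mul (h3 i)]
  norm_num
  field_simp
  ring

theorem IsGaussianLaw.exists_isOperatorPower (hP : IsGaussianLaw m S P) {c q : ℝ} (hc : 0 ≤ c)
    (hq : q ≤ 0) : ∃ R : H →L[ℝ] H, IsOperatorPower (1 + c • S) q R := by
  obtain ⟨s, b, l, h⟩ := hP.hasEigenexpansion
  have h1 := h.one_add_smul c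
  -- Eigenvalues at least `1` and `q ≤ 0` bound the powers by `1`, so they define a bounded
  -- operator.
  have h2 : ∀ i, 1 ≤ 1 + c * l i := fun i =>
    le_add_of_nonneg_right (mul_nonneg hc (hP.eigenvalue_nonneg h i))
  obtain ⟨R, hR⟩ := b.exists_diagonal
    (fun i => (fun t : ℝ => if 0 < t then t ^ q else 0) (1 + c * l i)) (C := 1) fun i => by
      have h3 : 0 < 1 + c * l i := zero_lt_one.trans_le (h2 i)
      simp only [if_pos h3]
      rw [abs_of_nonneg (by positivity)]
      exact Real.rpow_le_one_of_one_le_of_nonpos (h2 i) hq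
  exact ⟨R, hP.hasEigenexpansion_one_add_smul c, fun s' b' l' h' =>
    h1.transfer (f := fun t : ℝ => if 0 < t then t ^ q else 0) hR h'⟩

end Determinant

/-! ### The kernel mean embedding -/

section Embedding

variable {H : Type*} [NormedAddCommGroup H] [InnerProductSpace ℝ H]

/-- The canonical feature map of the Gaussian kernel. -/
noncomputable def gaussianFeature (σ : ℝ≥0) (x : H) : GaussianRKHS H σ :=
  RKHS.kerFun (GaussianRKHS H σ) x (1 : ℝ)

theorem inner_gaussianFeature {σ : ℝ≥0} (x : H) (f : GaussianRKHS H σ) :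
    ⟪gaussianFeature σ x, f⟫_ℝ = f x := by
  rw [gaussianFeature, RKHS.kerFun_inner]
  simp

theorem gaussianFeature_apply {σ : ℝ≥0} (x y : H) :
    gaussianFeature σ x y = Real.exp (-(σ * ‖x - y‖ ^ 2)) := by
  rw [gaussianFeature, RKHS.kerFun_apply, RKHS.OfKernel.kernel_ofKernel]
  simp [gaussianKernel, norm_sub_rev x y]

theorem norm_gaussianFeature {σ : ℝ≥0} (x : H) : ‖gaussianFeature σ x‖ = 1 := by
  have h : ‖gaussianFeature σ x‖ ^ 2 = 1 := by
    rw [← real_inner_self_eq_norm_sq, inner_gaussianFeature, gaussianFeature_apply]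
    simp
  exact (pow_eq_one_iff_of_nonneg (norm_nonneg _) two_ne_zero).1 h

/-- From `‖φ y - φ x‖² = 2 - 2 k(y, x)`. Continuity gives the strong measurability needed for the
Bochner integral. -/
theorem continuous_gaussianFeature (σ : ℝ≥0) : Continuous (gaussianFeature (H := H) σ) := by
  rw [continuous_iff_continuousAt]
  intro x
  have h1 : ∀ y, ‖gaussianFeature σ y - gaussianFeature σ x‖ =
      √(2 - 2 * Real.exp (-(σ * ‖y - x‖ ^ 2))) := by
    intro y
    rw [← Real.sqrt_sq (norm_nonneg (gaussianFeature σ y - gaussianFeature σ x)),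
      norm_sub_sq_real, norm_gaussianFeature, norm_gaussianFeature, inner_gaussianFeature,
      gaussianFeature_apply, norm_sub_rev]
    congr 1
    ring
  rw [ContinuousAt, tendsto_iff_norm_sub_tendsto_zero]
  simp only [h1]
  have h2 : Continuous fun y : H => √(2 - 2 * Real.exp (-(σ * ‖y - x‖ ^ 2))) := by fun_prop
  simpa using h2.tendsto x

variable [TopologicalSpace.SeparableSpace H] [MeasurableSpace H] [BorelSpace H]
  {P : Measure H} [IsProbabilityMeasure P]

theorem integrable_gaussianFeature (σ : ℝ≥0) : Integrable (gaussianFeature (H := H) σ) P := by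
  have := UniformSpace.secondCountable_of_separable H
  exact Integrable.of_bound (C := 1) (continuous_gaussianFeature σ).aestronglyMeasurable
    (.of_forall fun x => (norm_gaussianFeature x).le)

theorem isMeanEmbedding_integral_gaussianFeature (σ : ℝ≥0) :
    IsMeanEmbedding P (∫ x, gaussianFeature σ x ∂P) := by
  intro f
  have h := (integrable_gaussianFeature (P := P) σ).const_inner (𝕜 := ℝ) f
  have h1 := integral_inner (𝕜 := ℝ) (integrable_gaussianFeature (P := P) σ) f
  have h2 : ∀ x, ⟪f, gaussianFeature σ x⟫_ℝ = f x := fun x => by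
    rw [real_inner_comm, inner_gaussianFeature]
  simp only [h2] at h h1
  exact ⟨h, by rw [h1, real_inner_comm]⟩

theorem integral_gaussianFeature_apply (σ : ℝ≥0) (y : H) :
    (∫ x, gaussianFeature σ x ∂P) y = ∫ x, Real.exp (-(σ * ‖x - y‖ ^ 2)) ∂P := by
  rw [← inner_gaussianFeature, ← integral_inner (integrable_gaussianFeature σ)]
  simp only [inner_gaussianFeature, gaussianFeature_apply]

end Embedding

theorem IsMeanEmbedding.unique {X F : Type*} [MeasurableSpace X] [NormedAddCommGroup F]
    [InnerProductSpace ℝ F] [RKHS ℝ F X ℝ] {P : Measure X} {μ ν : F} (hμ : IsMeanEmbedding P μ)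
    (hν : IsMeanEmbedding P ν) : μ = ν :=
  ext_inner_right ℝ fun f => (hμ f).2.trans (hν f).2.symm

/-! ### Closed forms for the values and the norm of the embedding -/

section Formulas

variable {H : Type*} [NormedAddCommGroup H] [InnerProductSpace ℝ H]
  [TopologicalSpace.SeparableSpace H] [MeasurableSpace H] [BorelSpace H]
  {m : H} {S : H →L[ℝ] H} {P : Measure H}

theorem IsGaussianLaw.hasSum_norm_isOperatorPower (hP : IsGaussianLaw m S P) {c : ℝ} (hc : 0 ≤ c)
    {R : H →L[ℝ] H} (hR : IsOperatorPower (1 + c • S) (-1 / 2) R) {s : Set H}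
    {b : HilbertBasis s ℝ H} {l : s → ℝ} (h : IsEigenexpansion S b l) (x : H) :
    HasSum (fun i => ⟪x, b i⟫_ℝ ^ 2 / (1 + c * l i)) (‖R x‖ ^ 2) := by
  refine (b.hasSum_inner_sq (R x)).congr_fun fun i => ?_
  have h1 : 0 < 1 + c * l i := by
    have := hP.eigenvalue_nonneg h i
    positivity
  rw [(hR.2 s b _ (h.one_add_smul c)).inner_apply, if_pos h1, mul_pow, ← Real.rpow_mul_natCast h1.le,
    div_eq_inv_mul]
  norm_num [Real.rpow_neg_one]

variable [CompleteSpace H]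

theorem IsGaussianLaw.integral_exp_norm_sub (hP : IsGaussianLaw m S P) {a d : ℝ} (ha : 0 ≤ a)
    (hd : 0 < d) (hdet : HasDeterminant (1 + (2 * a) • S) d) {R : H →L[ℝ] H}
    (hR : IsOperatorPower (1 + (2 * a) • S) (-1 / 2) R) (y : H) :
    ∫ x, Real.exp (-(a * ‖x - y‖ ^ 2)) ∂P =
      d ^ (-1 / 2 : ℝ) * Real.exp (-a * ‖R (y - m)‖ ^ 2) := by
  obtain ⟨s, b, l, h⟩ := hP.hasEigenexpansion
  have h1 := hP.hasProd_eigenexpansion h y (a := fun _ => a) (fun _ => ha)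
    fun x => (b.hasSum_inner_sq (x - y)).mul_left a
  have h2 := hdet.hasProd_rpow hd (h.one_add_smul _) (fun i => by
    have := hP.eigenvalue_nonneg h i
    positivity) (-1 / 2)
  have h3 := ((hP.hasSum_norm_isOperatorPower (c := 2 * a) (by positivity) hR h (y - m)).mul_left
    (-a)).rexp
  refine h1.unique ((h2.mul h3).congr_fun fun i => ?_)
  rw [Function.comp_apply, ← neg_sub m y, inner_neg_left, neg_sq]
  congr 2
  ring

/-- Factor by factor this is `(1 + 2aλ) (1 + 2aλ / (1 + 2aλ)) = 1 + 4aλ`, raised to the power `-1 /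
2`. -/
theorem IsGaussianLaw.integral_exp_norm_isOperatorPower (hP : IsGaussianLaw m S P) {a d₂ d₄ : ℝ}
    (ha : 0 ≤ a) (hd₂ : 0 < d₂) (hd₄ : 0 < d₄) (hdet₂ : HasDeterminant (1 + (2 * a) • S) d₂)
    (hdet₄ : HasDeterminant (1 + (4 * a) • S) d₄) {R : H →L[ℝ] H}
    (hR : IsOperatorPower (1 + (2 * a) • S) (-1 / 2) R) :
    d₂ ^ (-1 / 2 : ℝ) * ∫ x, Real.exp (-(a * ‖R (x - m)‖ ^ 2)) ∂P = d₄ ^ (-1 / 2 : ℝ) := by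
  obtain ⟨s, b, l, h⟩ := hP.hasEigenexpansion
  have hl := hP.eigenvalue_nonneg h
  have hpos : ∀ i, 0 < 1 + 2 * a * l i := fun i => by
    have := hl i
    positivity
  have h1 := hP.hasProd_eigenexpansion h m (a := fun i => a / (1 + 2 * a * l i))
    (fun i => div_nonneg ha (hpos i).le) (g := fun x => a * ‖R (x - m)‖ ^ 2) fun x => by
      refine ((hP.hasSum_norm_isOperatorPower (c := 2 * a) (by positivity) hR h
        (x - m)).mul_left a).congr_fun fun i => ?_
      ring
  have h2 := hdet₂.hasProd_rpow hd₂ (h.one_add_smul _) hpos (-1 / 2)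
  have h4 := hdet₄.hasProd_rpow hd₄ (h.one_add_smul _) (fun i => by
    have := hl i
    positivity) (-1 / 2)
  refine (h2.mul h1).unique (h4.congr_fun fun i => ?_)
  have := hl i
  simp only [sub_self, inner_zero_left, ne_eq, OfNat.ofNat_ne_zero, not_false_eq_true, zero_pow,
    mul_zero, zero_div, neg_zero, Real.exp_zero, mul_one]
  rw [← Real.mul_rpow (hpos i).le (by positivity)]
  congr 1
  have := (hpos i).ne'
  field_simp
  ring

end Formulas

theorem mainTheorem3 {H : Type*} [NormedAddCommGroup H] [InnerProductSpace ℝ H] [CompleteSpace H]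
    [TopologicalSpace.SeparableSpace H] [MeasurableSpace H] [BorelSpace H]
    (σ : ℝ≥0) (hσ : 0 < σ) (m : H) (S : H →L[ℝ] H) (P : Measure H) (hP : IsGaussianLaw m S P) :
    ∃ (d₂ d₄ : ℝ) (R : H →L[ℝ] H),
      HasDeterminant (1 + (2 * (σ : ℝ)) • S) d₂ ∧ 0 < d₂ ∧
      HasDeterminant (1 + (4 * (σ : ℝ)) • S) d₄ ∧ 0 < d₄ ∧
      IsOperatorPower (1 + (2 * (σ : ℝ)) • S) (-1 / 2) R ∧
      ∃ μ : GaussianRKHS H σ,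
        (∀ ν : GaussianRKHS H σ, IsMeanEmbedding P ν ↔ ν = μ) ∧
        (∀ y : H, μ y = d₂ ^ (-1 / 2 : ℝ) * Real.exp (-(σ : ℝ) * ‖R (y - m)‖ ^ 2)) ∧
        ‖μ‖ ^ 2 = d₄ ^ (-1 / 2 : ℝ) := by
  have hσ' : (0 : ℝ) < σ := hσ
  have := hP.isProbabilityMeasure
  have hd₂ := hP.hasDeterminant (c := 2 * (σ : ℝ)) (by positivity)
  have hd₄ := hP.hasDeterminant (c := 4 * (σ : ℝ)) (by positivity)
  have hd₂pos := Real.rpow_pos_of_pos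
    (hP.integral_exp_norm_pos (c := 2 * (σ : ℝ) / 2) (by positivity)) (-2)
  have hd₄pos := Real.rpow_pos_of_pos
    (hP.integral_exp_norm_pos (c := 4 * (σ : ℝ) / 2) (by positivity)) (-2)
  obtain ⟨R, hR⟩ := hP.exists_isOperatorPower (c := 2 * (σ : ℝ)) (q := -1 / 2) (by positivity)
    (by norm_num)
  have hμ := isMeanEmbedding_integral_gaussianFeature (P := P) σ
  have hval : ∀ y, (∫ x, gaussianFeature σ x ∂P) y = _ := fun y =>
    (integral_gaussianFeature_apply σ y).trans
      (hP.integral_exp_norm_sub hσ'.le hd₂pos hd₂ hR y)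
  refine ⟨_, _, R, hd₂, hd₂pos, hd₄, hd₄pos, hR, ∫ x, gaussianFeature σ x ∂P,
    fun ν => ⟨fun hν => hν.unique hμ, fun hν => hν ▸ hμ⟩, hval, ?_⟩
  -- The embedding is tested against itself: `‖μ‖² = E μ(Y)`.
  rw [← real_inner_self_eq_norm_sq, (hμ _).2]
  simp only [hval]
  rw [integral_const_mul]
  simp only [neg_mul]
  exact hP.integral_exp_norm_isOperatorPower hσ'.le hd₂pos hd₄pos hd₂ hd₄ hR
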